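/- Let $n,m,p\in\mathbb N$ and consider the linear time-invariant system $\Sigma$: $\dot x=Ax+Bu$, $x(0)=x_0$, $y=Cx+Du$, with real matrices $A\in\mathbb R^{n\times n}$, $B\in\mathbb R^{n\times m}$, $C\in\mathbb R^{p\times n}$, $D\in\mathbb R^{p\times m}$. Let $\mathcal U\subseteq\mathbb R^m$ and $\mathcal X\subseteq\mathbb R^n$ be arbitrary sets, and let $\mathfrak S$ be the system obtained from $\Sigma$ by imposing $u(t)\in\mathcal U$ and $x(t)\in\mathcal X$ for all $t\ge 0$. Inputs $u$ are causal (zero for $t<0$), piecewise continuous (finitely many discontinuities on each bounded interval, finite one-sided limits) and exponentially bounded; state trajectories are continuous, and outputs piecewise continuous, on $[0,\infty)$. The state equation is understood in integrated form, and equality of input signals and of output signals means equality at almost every $t\ge0$. For $x_0\in\mathbb R^n$ let $\mathbf Q(x_0)$ be the set of triples $(u,x,y)$ of such signals where $x$ is the state trajectory produced by $u$ from $x(0)=x_0$, $y=Cx+Du$, and $u(t)\in\mathcal U$, $x(t)\in\mathcal X$ for all $t\ge0$. A pair $(x_0,y)$, with $x_0\in\mathcal X$ and $y$ an output signal, is *admissible*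 for $\mathfrak S$ if $(u,x,y)\in\mathbf Q(x_0)$ for some $(u,x)$, and *input redundant* for $\mathfrak S$ if there are $(u_1,x_1,y_1),(u_2,x_2,y_2)\in\mathbf Q(x_0)$ with $u_1\ne u_2$ (that is, $u_1$ and $u_2$ differ on a set of positive measure) and $y_1=y_2=y$. The unconstrained system $\Sigma$ is *input redundant* if, for $\mathcal U=\mathbb R^m$ and $\mathcal X=\mathbb R^n$, some pair $(x_0,y)$ is input redundant. **Theorem.** Let $\rho=\dim(\ker B\cap\ker D)$ and assume that the unconstrained system $\Sigma$ is input redundant. Let $(x_0,y)$ be an admissible pair for $\mathfrak S$, and suppose that there exist $(u,x)$ and $0\le t_0<t_f$ such that $(u,x,y)\in\mathbf Q(x_0)$ and - if $\rho>0$, then $u(t)\in\operatorname{int}(\mathcal U)$ for all $t\in\,]t_0,t_f[$; - if $\rho=0$, then $u(t)\in\operatorname{int}(\mathcal U)$ and $x(t)\in\operatorname{int}(\mathcal X)$ for all $t\in\,]t_0,t_f[$. Then $(x_0,y)$ is input redundant for $\mathfrak S$. -/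

import Mathlib

open Set Filter Topology MeasureTheory
open scoped Matrix

/-- The linear time-invariant system `x' = A x + B u`, `y = C x + D u` with `m` inputs, `n` states
and `p` outputs. -/
structure LTISystem (n m p : ℕ) where
  A : Matrix (Fin n) (Fin n) ℝ
  B : Matrix (Fin n) (Fin m) ℝ
  C : Matrix (Fin p) (Fin n) ℝ
  D : Matrix (Fin p) (Fin m) ℝ

/-- Signals live on the time set `[0, ∞)`. They are represented by functions on `ℝ` of which only
the values on `[0, ∞)` matter (inputs are moreover required to vanish for negative times). -/
abbrev Signal (k : ℕ) : Type := ℝ → (Fin k → ℝ)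

/-- Equality of signals: equality at almost every time of `[0, ∞)`. -/
def SignalEq {k : ℕ} (f g : Signal k) : Prop :=
  ∀ᵐ t ∂(volume.restrict (Ici (0 : ℝ))), f t = g t

/-- Piecewise continuity on `[0, ∞)`: finitely many discontinuities on every bounded interval,
and finite one-sided limits everywhere. -/
def PiecewiseContinuous {k : ℕ} (f : Signal k) : Prop :=
  (∀ T : ℝ, {t ∈ Icc 0 T | ¬ ContinuousWithinAt f (Ici 0) t}.Finite) ∧
  (∀ t : ℝ, 0 < t → ∃ l, Tendsto f (𝓝[<] t) (𝓝 l)) ∧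
  (∀ t : ℝ, 0 ≤ t → ∃ l, Tendsto f (𝓝[>] t) (𝓝 l))

/-- Unconstrained input space: causal, piecewise continuous, exponentially bounded signals. -/
def inputSpace (m : ℕ) : Set (Signal m) :=
  {u | (∀ t < 0, u t = 0) ∧ PiecewiseContinuous u ∧
    ∃ M a : ℝ, ∀ t, 0 ≤ t → ‖u t‖ ≤ M * Real.exp (a * t)}

/-- Unconstrained state space of signals: continuous functions on `[0, ∞)`. -/
def stateSpace (n : ℕ) : Set (Signal n) := {x | ContinuousOn x (Ici 0)}

/-- Output signals: piecewise continuous functions on `[0, ∞)`. -/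
def outputSpace (p : ℕ) : Set (Signal p) := {y | PiecewiseContinuous y}

/-- Inputs satisfying the constraint `u(t) ∈ U` at every time `t ≥ 0`. -/
def constrainedInputs {m : ℕ} (U : Set (Fin m → ℝ)) : Set (Signal m) :=
  {u | ∀ t, 0 ≤ t → u t ∈ U} ∩ inputSpace m

/-- State signals satisfying the constraint `x(t) ∈ X` at every time `t ≥ 0`. -/
def constrainedStates {n : ℕ} (X : Set (Fin n → ℝ)) : Set (Signal n) :=
  {x | ∀ t, 0 ≤ t → x t ∈ X} ∩ stateSpace n

namespace LTISystem

variable {n m p : ℕ}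

/-- `x` is the state trajectory produced by the input `u` from the initial state `x₀`: the
solution of `x' = A x + B u`, `x(0) = x₀`. As `u` is only piecewise continuous, the differential
equation is understood in integrated form. -/
def IsStateTrajectory (S : LTISystem n m p) (x₀ : Fin n → ℝ) (u : Signal m) (x : Signal n) :
    Prop :=
  ∀ t, 0 ≤ t → x t = x₀ + ∫ s in (0 : ℝ)..t, (S.A *ᵥ x s + S.B *ᵥ u s)

/-- Triples `(u, x, y)` compatible for `x₀` with the unconstrained system. -/
def unconstrainedTriples (S : LTISystem n m p) (x₀ : Fin n → ℝ) :
    Set (Signal m × Signal n × Signal p) :=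
  {q | q.1 ∈ inputSpace m ∧ q.2.1 ∈ stateSpace n ∧ q.2.2 ∈ outputSpace p ∧
    S.IsStateTrajectory x₀ q.1 q.2.1 ∧
    SignalEq q.2.2 (fun t => S.C *ᵥ q.2.1 t + S.D *ᵥ q.1 t)}

/-- Triples `(u, x, y)` compatible for `x₀` with the system subject to the input constraint set
`U` and the state constraint set `X`. -/
def triples (S : LTISystem n m p) (U : Set (Fin m → ℝ)) (X : Set (Fin n → ℝ))
    (x₀ : Fin n → ℝ) : Set (Signal m × Signal n × Signal p) :=
  S.unconstrainedTriples x₀ ∩ (constrainedInputs U ×ˢ constrainedStates X ×ˢ outputSpace p)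

/-- Input-output pairs `(u, y)` compatible for `x₀` with the constrained system. -/
def pairs (S : LTISystem n m p) (U : Set (Fin m → ℝ)) (X : Set (Fin n → ℝ))
    (x₀ : Fin n → ℝ) : Set (Signal m × Signal p) :=
  {w | ∃ x, (w.1, x, w.2) ∈ S.triples U X x₀}

/-- The set of admissible pairs `(x₀, y)` of the constrained system. -/
def admissiblePairs (S : LTISystem n m p) (U : Set (Fin m → ℝ)) (X : Set (Fin n → ℝ)) :
    Set ((Fin n → ℝ) × Signal p) :=
  {z | z ∈ X ×ˢ outputSpace p ∧ ∃ u, (u, z.2) ∈ S.pairs U X z.1}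

/-- The set of input redundant pairs `(x₀, y)` of the constrained system: `y` is produced from
`x₀` by two distinct inputs. -/
def redundantPairs (S : LTISystem n m p) (U : Set (Fin m → ℝ)) (X : Set (Fin n → ℝ)) :
    Set ((Fin n → ℝ) × Signal p) :=
  {z | z ∈ X ×ˢ outputSpace p ∧
    ∃ u₁ y₁ u₂ y₂, (u₁, y₁) ∈ S.pairs U X z.1 ∧ (u₂, y₂) ∈ S.pairs U X z.1 ∧
      ¬ SignalEq u₁ u₂ ∧ SignalEq y₁ y₂ ∧ SignalEq y₂ z.2}

/-- The constrained system is input redundant if it has an input redundant pair. -/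
def IsInputRedundant (S : LTISystem n m p) (U : Set (Fin m → ℝ)) (X : Set (Fin n → ℝ)) : Prop :=
  (S.redundantPairs U X).Nonempty

/-- `ρ = dim (ker B ∩ ker D)`. -/
noncomputable def rho (S : LTISystem n m p) : ℕ :=
  Module.finrank ℝ ↥(LinearMap.ker S.B.mulVecLin ⊓ LinearMap.ker S.D.mulVecLin)

end LTISystem

/-! Let `J` denote integration from 0. The difference of two trajectories with the same initial
state and output is a null solution: z = J(Az + Bv), Cz + Dv = 0. These equations are linear over
ℝ[X] with X acting as `J`, and the continuous functions form a torsion-free ℝ[X]-module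
(`injective_aeval_volterra`). A nonzero null solution therefore forces `pencil` to have a nonzero
kernel vector (ξ, ω) with polynomial entries (`exists_mulVec_eq_zero_of_representation`).

Such a vector is a recipe for localized null solutions: if f and enough of its iterated primitives
are supported in ]a, b[, then v = ω(J)f and z = ξ(J)f are supported there too
(`exists_supported_null_solution_of_pencil`). When ρ > 0, a bump times a vector of ker B ∩ ker D
does the same with z = 0, so the state needs no room.

Finally, ]t₀, t_f[ contains a compact interval on which u is continuous; by compactness, a small
multiple of (v, z) can be added to (u, x) without leaving the constraint sets. -/

/-! ### Polynomial matrices acting on torsion-free modules. -/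

open Polynomial in
theorem sum_representation_mul {ι κ α E : Type*} [Fintype α] [Fintype κ] [AddCommGroup E]
    [Module ℝ E] (φ : ℝ[X] →+* Module.End ℝ E) (P : Matrix ι α ℝ[X]) (Q : Matrix α κ ℝ[X])
    (e : κ → E) (i : ι) :
    ∑ j, φ ((P * Q) i j) (e j) = ∑ k, φ (P i k) (∑ j, φ (Q k j) (e j)) := by
  simp only [Matrix.mul_apply, map_sum, LinearMap.sum_apply, map_mul, Module.End.mul_apply]
  exact Finset.sum_comm

open Polynomial in
/-- Over `ℝ[X]`, if a nonzero vector of a torsion-free representation is killed by the matrix `N`,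
then `N` has a nonzero polynomial kernel vector. -/
theorem exists_mulVec_eq_zero_of_representation {ι κ E : Type*} [Fintype ι] [Fintype κ]
    [DecidableEq κ] [AddCommGroup E] [Module ℝ E] (φ : ℝ[X] →+* Module.End ℝ E)
    (hφ : ∀ p, p ≠ 0 → Function.Injective (φ p)) (N : Matrix ι κ ℝ[X]) (e : κ → E) (he : e ≠ 0)
    (hN : ∀ i, ∑ j, φ (N i j) (e j) = 0) : ∃ g : κ → ℝ[X], g ≠ 0 ∧ N *ᵥ g = 0 := by
  -- `N` need not be square, so Cramer's rule is applied to NᵀN: multiplying N e = 0 by adj(NᵀN)Nᵀ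
  -- gives det(NᵀN) e = 0, and torsion-freeness would force e = 0.
  have hdet : (Nᵀ * N).det = 0 := by
    by_contra hd
    apply he
    funext i
    apply hφ _ hd
    have h1 : ∑ j, φ (((Nᵀ * N).adjugate * (Nᵀ * N)) i j) (e j) = 0 := by
      simp only [sum_representation_mul, hN, map_zero, Finset.sum_const_zero]
    rw [Matrix.adjugate_mul] at h1
    rw [Finset.sum_eq_single i] at h1
    · simpa using h1
    · intro j _ hj
      simp [Matrix.one_apply_ne hj.symm]
    · simp
  obtain ⟨g, hg, h⟩ := Matrix.exists_mulVec_eq_zero_iff.2 hdet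
  refine ⟨g, hg, ?_⟩
  -- A sum of squares of real polynomials vanishes only if each term does, as evaluation at real
  -- points shows.
  have h2 : (N *ᵥ g) ⬝ᵥ (N *ᵥ g) = 0 := by
    have : (N *ᵥ g) ⬝ᵥ (N *ᵥ g) = g ⬝ᵥ ((Nᵀ * N) *ᵥ g) := by
      rw [← Matrix.mulVec_mulVec, Matrix.dotProduct_mulVec g, Matrix.vecMul_transpose]
    rw [this, h, dotProduct_zero]
  funext i
  refine Polynomial.funext fun r => ?_
  have h3 := congrArg (Polynomial.eval r) h2
  simp only [dotProduct, Polynomial.eval_finsetSum, Polynomial.eval_mul, Polynomial.eval_zero]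
    at h3
  have h4 := (Finset.sum_eq_zero_iff_of_nonneg (fun j _ => mul_self_nonneg _)).1 h3 i
    (Finset.mem_univ i)
  simpa using h4

/-! ### The integration operator: torsion-freeness and localized functions. -/

/-- Integration from `0`, as a linear endomorphism of the continuous functions on `ℝ`. -/
noncomputable def volterra (𝕜 : Type*) [RCLike 𝕜] : Module.End 𝕜 C(ℝ, 𝕜) where
  toFun f := ⟨fun t => ∫ s in (0 : ℝ)..t, f s,
    intervalIntegral.continuous_primitive (fun _ _ => f.continuous.intervalIntegrable _ _) 0⟩
  map_add' f g := by
    ext t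
    exact intervalIntegral.integral_add (f.continuous.intervalIntegrable _ _)
      (g.continuous.intervalIntegrable _ _)
  map_smul' c f := by
    ext t
    exact intervalIntegral.integral_const_mul c _

theorem volterra_apply {𝕜 : Type*} [RCLike 𝕜] (f : C(ℝ, 𝕜)) (t : ℝ) :
    volterra 𝕜 f t = ∫ s in (0 : ℝ)..t, f s := rfl

theorem hasDerivAt_volterra {𝕜 : Type*} [RCLike 𝕜] (f : C(ℝ, 𝕜)) (t : ℝ) :
    HasDerivAt (volterra 𝕜 f) (f t) t :=
  f.continuous.integral_hasStrictDerivAt 0 t |>.hasDerivAt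

theorem volterra_eq_zero {𝕜 : Type*} [RCLike 𝕜] {f : C(ℝ, 𝕜)} (h : volterra 𝕜 f = 0) :
    f = 0 := by
  ext t
  have h1 := hasDerivAt_volterra f t
  rw [h] at h1
  exact h1.unique (hasDerivAt_const t 0)

/-- For r ≠ 0, the primitive F = Jf solves F' = F/r with F(0) = 0, so exp(-t/r)F is constant and
equal to 0. For r = 0, differentiate. -/
theorem eq_zero_of_volterra_eq_smul {f : C(ℝ, ℂ)} {r : ℂ} (h : volterra ℂ f = r • f) : f = 0 := by
  by_cases hr : r = 0
  · exact volterra_eq_zero (by rw [h, hr]; ext t; simp)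
  have hf : ∀ t, f t = r⁻¹ * volterra ℂ f t := by
    intro t
    rw [h]
    simp [hr]
  have hg : ∀ t : ℝ, HasDerivAt (fun t : ℝ => Complex.exp (-(r⁻¹ * t)) * volterra ℂ f t) 0 t := by
    intro t
    have h1 : HasDerivAt (fun t : ℝ => -(r⁻¹ * (t : ℂ))) (-(r⁻¹ * 1)) t :=
      ((Complex.ofRealCLM.hasDerivAt (x := t)).const_mul r⁻¹).neg
    refine (h1.cexp.mul (hasDerivAt_volterra f t)).congr_deriv ?_
    rw [hf t]
    ring
  apply volterra_eq_zero
  ext t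
  have h2 := is_const_of_deriv_eq_zero (fun t => (hg t).differentiableAt) (fun t => (hg t).deriv) t 0
  simpa [volterra_apply] using h2

-- Over ℂ the polynomial splits into linear factors X - r, and each `J` - r is injective because `J`
-- has no eigenvalue.
open Polynomial in
theorem injective_aeval_volterra_complex (p : ℂ[X]) (hp : p ≠ 0) :
    Function.Injective (aeval (volterra ℂ) p) := by
  induction hn : p.natDegree using Nat.strong_induction_on generalizing p with
  | _ k ih =>
    by_cases hd : p.degree = 0
    · rw [eq_C_of_degree_eq_zero hd] at hp ⊢
      rw [aeval_C]
      intro f g hfg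
      simpa [Module.algebraMap_end_apply] using
        (smul_right_injective _ (by simpa using hp : p.coeff 0 ≠ 0)) hfg
    · obtain ⟨r, hr⟩ := IsAlgClosed.exists_root p hd
      obtain ⟨q, rfl⟩ := dvd_iff_isRoot.2 hr
      have hq : q ≠ 0 := right_ne_zero_of_mul hp
      rw [map_mul]
      refine Function.Injective.comp (g := aeval (volterra ℂ) (X - C r)) ?_
        (ih q.natDegree ?_ q hq rfl)
      · rw [injective_iff_map_eq_zero]
        intro f hf
        refine eq_zero_of_volterra_eq_smul (r := r) (sub_eq_zero.1 ?_)
        simpa [Module.algebraMap_end_apply] using hf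
      · rw [← hn, natDegree_mul (X_sub_C_ne_zero r) hq, natDegree_X_sub_C]
        omega

open Polynomial in
/-- No nonzero real polynomial in the integration operator kills a nonzero continuous function. -/
theorem injective_aeval_volterra (p : ℝ[X]) (hp : p ≠ 0) :
    Function.Injective (aeval (volterra ℝ) p) := by
  -- Complexification is injective and commutes with integration, which transfers the complex case.
  let Φ : C(ℝ, ℝ) →ₗ[ℝ] C(ℝ, ℂ) :=
    { toFun := fun f => ⟨fun t => (f t : ℂ), by fun_prop⟩
      map_add' := fun f g => by ext t; simp
      map_smul' := fun c f => by ext t; simp }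
  have hΦ : ∀ f t, Φ f t = (f t : ℂ) := fun _ _ => rfl
  have hJ : ∀ f, Φ (volterra ℝ f) = volterra ℂ (Φ f) := by
    intro f
    ext t
    simp only [hΦ, volterra_apply]
    exact intervalIntegral.integral_ofReal.symm
  have hpow : ∀ k f, Φ ((volterra ℝ ^ k) f) = (volterra ℂ ^ k) (Φ f) := by
    intro k
    induction k with
    | zero => simp
    | succ k ih => intro f; rw [pow_succ, pow_succ, Module.End.mul_apply, ih, hJ]; rfl
  have hcomm : ∀ (q : ℝ[X]) f, Φ (aeval (volterra ℝ) q f) =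
      aeval (volterra ℂ) (q.map (algebraMap ℝ ℂ)) (Φ f) := by
    intro q f
    induction q using Polynomial.induction_on' with
    | add q₁ q₂ h₁ h₂ => simp [h₁, h₂]
    | monomial k a =>
      rw [map_monomial, aeval_monomial, aeval_monomial, Module.End.mul_apply, Module.End.mul_apply,
        Module.algebraMap_end_apply, Module.algebraMap_end_apply, map_smul, hpow]
      rfl
  rw [injective_iff_map_eq_zero]
  intro f hf
  have h1 : Φ f = 0 := by
    apply injective_aeval_volterra_complex (p.map (algebraMap ℝ ℂ))
      ((Polynomial.map_ne_zero_iff (algebraMap ℝ ℂ).injective).2 hp)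
    rw [← hcomm, hf, map_zero, map_zero]
  ext t
  have := congrArg (fun g : C(ℝ, ℂ) => g t) h1
  simpa [hΦ] using this

open Polynomial in
theorem aeval_volterra_apply_eq_zero {k : ℕ} {s : Set ℝ} {f : C(ℝ, ℝ)}
    (hf : ∀ j ≤ k, ∀ t ∉ s, (volterra ℝ ^ j) f t = 0) {p : ℝ[X]} (hp : p.natDegree ≤ k)
    {t : ℝ} (ht : t ∉ s) : aeval (volterra ℝ) p f t = 0 := by
  rw [aeval_eq_sum_range, LinearMap.sum_apply, ContinuousMap.sum_apply]
  refine Finset.sum_eq_zero fun j hj => ?_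
  have hj' : j ≤ k := (Nat.lt_succ_iff.1 (Finset.mem_range.1 hj)).trans hp
  simp [hf j hj' t ht]

/-- There are nonzero continuous functions supported in a given interval whose first `k` iterated
primitives are supported there too. -/
theorem exists_iterated_volterra_supported {a b : ℝ} (ha : 0 ≤ a) (hab : a < b) (k : ℕ) :
    ∃ f : C(ℝ, ℝ), f ≠ 0 ∧ ∀ j ≤ k, ∀ t ∉ Ioo a b, (volterra ℝ ^ j) f t = 0 := by
  -- The function for k + 1 is the derivative of the one for k, so the induction must also carry
  -- smoothness and the closed support. Since 0 lies outside ]a, b[, integrating that derivative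
  -- from 0 recovers the previous function.
  suffices h : ∃ f : C(ℝ, ℝ), f ≠ 0 ∧ ContDiff ℝ (⊤ : ℕ∞) f ∧ tsupport f ⊆ Ioo a b ∧
      ∀ j ≤ k, ∀ t ∉ Ioo a b, (volterra ℝ ^ j) f t = 0 by
    obtain ⟨f, h1, -, -, h2⟩ := h
    exact ⟨f, h1, h2⟩
  induction k with
  | zero =>
    obtain ⟨f, hs, -, hc, -, hf⟩ := exists_contDiff_tsupport_subset (n := ⊤)
      (Ioo_mem_nhds (left_lt_add_div_two.2 hab) (add_div_two_lt_right.2 hab))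
    refine ⟨⟨f, hc.continuous⟩, ?_, hc, hs, ?_⟩
    · intro h
      have := congrArg (fun g : C(ℝ, ℝ) => g ((a + b) / 2)) h
      simp [hf] at this
    · intro j hj t ht
      rw [Nat.le_zero.1 hj]
      exact image_eq_zero_of_notMem_tsupport fun h => ht (hs h)
  | succ k ih =>
    obtain ⟨f, hf, hc, hs, hJ⟩ := ih
    have hc' : ContDiff ℝ (⊤ : ℕ∞) (deriv f) := ContDiff.deriv' (by simpa using hc)
    let g : C(ℝ, ℝ) := ⟨deriv f, hc'.continuous⟩
    have hg : volterra ℝ g = f := by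
      ext t
      rw [volterra_apply]
      have h0 : f 0 = 0 := image_eq_zero_of_notMem_tsupport fun h => (hs h).1.not_ge ha
      have := intervalIntegral.integral_deriv_eq_sub (a := 0) (b := t) (f := f)
        (fun x _ => (hc.differentiable (by simp)).differentiableAt)
        (hc'.continuous.intervalIntegrable _ _)
      rw [h0, sub_zero] at this
      exact this
    have hgs : tsupport g ⊆ Ioo a b := tsupport_deriv_subset.trans hs
    refine ⟨g, ?_, hc', hgs, ?_⟩
    · rintro h
      rw [h, map_zero] at hg
      exact hf hg.symm
    · intro j hj t ht
      rcases j with _ | j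
      · exact image_eq_zero_of_notMem_tsupport fun h => ht (hgs h)
      · rw [pow_succ, Module.End.mul_apply, hg]
        exact hJ j (Nat.le_of_succ_le_succ hj) t ht

/-! ### Null solutions with prescribed support. -/

namespace LTISystem

variable {n m p : ℕ}

open Polynomial in
/-- The pencil of the integrated system equations `x = J (A x + B u)`, `C x + D u = 0`, as a
matrix of polynomials in the integration operator `J`. -/
noncomputable def pencil (S : LTISystem n m p) :
    Matrix (Fin n ⊕ Fin p) (Fin n ⊕ Fin m) ℝ[X] :=
  Matrix.fromBlocks (1 - (X : ℝ[X]) • S.A.map Polynomial.C)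
    (-((X : ℝ[X]) • S.B.map Polynomial.C))
    (S.C.map Polynomial.C) (S.D.map Polynomial.C)

-- The point is that the input part ω is nonzero. If it vanished, then ξ = X A ξ, so every power of
-- X would divide ξ, giving ξ = 0 as well.
open Polynomial in
theorem exists_polynomial_solution (S : LTISystem n m p)
    (h : ∃ g : Fin n ⊕ Fin m → ℝ[X], g ≠ 0 ∧ S.pencil *ᵥ g = 0) :
    ∃ (ξ : Fin n → ℝ[X]) (ω : Fin m → ℝ[X]), ω ≠ 0 ∧
      (∀ i, ξ i = X * (∑ j, Polynomial.C (S.A i j) * ξ j + ∑ j, Polynomial.C (S.B i j) * ω j)) ∧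
      ∀ i, ∑ j, Polynomial.C (S.C i j) * ξ j + ∑ j, Polynomial.C (S.D i j) * ω j = 0 := by
  obtain ⟨g, hg, h⟩ := h
  have h1 : ∀ i, g (.inl i) =
      X * (∑ j, Polynomial.C (S.A i j) * g (.inl j) +
        ∑ j, Polynomial.C (S.B i j) * g (.inr j)) := by
    intro i
    have := congrFun h (.inl i)
    simp only [pencil, Matrix.mulVec, dotProduct, Fintype.sum_sum_type, Matrix.fromBlocks_apply₁₁,
      Matrix.fromBlocks_apply₁₂, Matrix.sub_apply, Matrix.smul_apply, Matrix.map_apply,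
      Matrix.neg_apply, smul_eq_mul, sub_mul, Finset.sum_sub_distrib, neg_mul,
      Finset.sum_neg_distrib, Pi.zero_apply, Matrix.one_apply, ite_mul, one_mul, zero_mul,
      Finset.sum_ite_eq, Finset.mem_univ, if_true, mul_assoc, ← Finset.mul_sum] at this
    linear_combination this
  have h2 : ∀ i, ∑ j, Polynomial.C (S.C i j) * g (.inl j) +
      ∑ j, Polynomial.C (S.D i j) * g (.inr j) = 0 := by
    intro i
    have := congrFun h (.inr i)
    simpa [pencil, Matrix.mulVec, dotProduct] using this
  refine ⟨fun i => g (.inl i), fun i => g (.inr i), ?_, h1, h2⟩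
  intro h0
  have h0' : ∀ i, g (.inr i) = 0 := congrFun h0
  have hdvd : ∀ k, ∀ i, X ^ k ∣ g (.inl i) := by
    intro k
    induction k with
    | zero => simp
    | succ k ih =>
      intro i
      rw [h1, pow_succ']
      simp only [h0', mul_zero, Finset.sum_const_zero, add_zero]
      exact mul_dvd_mul_left X (Finset.dvd_sum fun j _ => (ih j).mul_left _)
  apply hg
  funext i
  rcases i with i | i
  · refine eq_zero_of_dvd_of_natDegree_lt (hdvd ((g (.inl i)).natDegree + 1) i) ?_
    simp
  · exact h0' i

open Polynomial in
/-- A nonzero polynomial kernel vector of the pencil yields nonzero inputs, supported in a given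
interval, which steer the system from rest to rest with zero output. -/
theorem exists_supported_null_solution_of_pencil (S : LTISystem n m p)
    (h : ∃ g : Fin n ⊕ Fin m → ℝ[X], g ≠ 0 ∧ S.pencil *ᵥ g = 0)
    {a b : ℝ} (ha : 0 ≤ a) (hab : a < b) :
    ∃ (v : Signal m) (z : Signal n), Continuous v ∧ Continuous z ∧ v ≠ 0 ∧
      (∀ t ∉ Ioo a b, v t = 0) ∧ (∀ t ∉ Ioo a b, z t = 0) ∧
      (∀ t, z t = ∫ s in (0 : ℝ)..t, (S.A *ᵥ z s + S.B *ᵥ v s)) ∧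
      ∀ t, S.C *ᵥ z t + S.D *ᵥ v t = 0 := by
  obtain ⟨ξ, ω, hω, hξ, hC⟩ := S.exists_polynomial_solution h
  -- A common degree bound: only the first k primitives of f enter ξ(J)f and ω(J)f.
  let k := (∑ i, (ξ i).natDegree) + ∑ i, (ω i).natDegree
  have hξk : ∀ i, (ξ i).natDegree ≤ k := fun i =>
    (Finset.single_le_sum (f := fun i => (ξ i).natDegree) (fun _ _ => Nat.zero_le _)
      (Finset.mem_univ i)).trans (Nat.le_add_right _ _)
  have hωk : ∀ i, (ω i).natDegree ≤ k := fun i =>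
    (Finset.single_le_sum (f := fun i => (ω i).natDegree) (fun _ _ => Nat.zero_le _)
      (Finset.mem_univ i)).trans (Nat.le_add_left _ _)
  obtain ⟨f, hf, hs⟩ := exists_iterated_volterra_supported ha hab k
  let v : Signal m := fun t i => aeval (volterra ℝ) (ω i) f t
  let z : Signal n := fun t i => aeval (volterra ℝ) (ξ i) f t
  have hv : Continuous v := continuous_pi fun i => ContinuousMap.continuous _
  have hz : Continuous z := continuous_pi fun i => ContinuousMap.continuous _
  refine ⟨v, z, hv, hz, ?_, fun t ht => ?_, fun t ht => ?_, fun t => ?_, fun t => ?_⟩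
  · intro h0
    obtain ⟨i, hi⟩ := Function.ne_iff.1 hω
    apply hf
    apply injective_aeval_volterra (ω i) hi
    ext t
    simpa using congrFun (congrFun h0 t) i
  · exact funext fun i => aeval_volterra_apply_eq_zero hs (hωk i) ht
  · exact funext fun i => aeval_volterra_apply_eq_zero hs (hξk i) ht
  · funext i
    have hint : IntervalIntegrable (fun s => S.A *ᵥ z s + S.B *ᵥ v s) volume 0 t :=
      ((continuous_const.matrix_mulVec hz).add
        (continuous_const.matrix_mulVec hv)).intervalIntegrable _ _
    have h1 := (ContinuousLinearMap.proj (R := ℝ) (φ := fun _ : Fin n => ℝ)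
      i).intervalIntegral_comp_comm hint
    simp only [ContinuousLinearMap.proj_apply] at h1
    rw [← h1]
    change aeval (volterra ℝ) (ξ i) f t = _
    rw [hξ i, map_mul, aeval_X, Module.End.mul_apply, volterra_apply]
    congr 1
    funext s
    simp [Matrix.mulVec, dotProduct, v, z, Module.algebraMap_end_apply]
  · funext i
    have h1 := congrArg (fun q => aeval (volterra ℝ) q f t) (hC i)
    simpa [Matrix.mulVec, dotProduct, v, z, Module.algebraMap_end_apply] using h1

/-- If `ker B ∩ ker D` is nontrivial, inputs valued in it leave both state and output unchanged. -/
theorem exists_supported_null_input (S : LTISystem n m p) (h : 0 < S.rho)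
    {a b : ℝ} (ha : 0 ≤ a) (hab : a < b) :
    ∃ v : Signal m, Continuous v ∧ v ≠ 0 ∧ (∀ t ∉ Ioo a b, v t = 0) ∧
      ∀ t, S.B *ᵥ v t = 0 ∧ S.D *ᵥ v t = 0 := by
  obtain ⟨f, hf, hs⟩ := exists_iterated_volterra_supported ha hab 0
  have : Nontrivial ↥(LinearMap.ker S.B.mulVecLin ⊓ LinearMap.ker S.D.mulVecLin) :=
    Module.nontrivial_of_finrank_pos h
  obtain ⟨⟨w, hw⟩, hw0⟩ := exists_ne
    (0 : ↥(LinearMap.ker S.B.mulVecLin ⊓ LinearMap.ker S.D.mulVecLin))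
  have hw0' : w ≠ 0 := fun h => hw0 (Subtype.ext h)
  have hB : S.B *ᵥ w = 0 := hw.1
  have hD : S.D *ᵥ w = 0 := hw.2
  refine ⟨fun t => f t • w, by fun_prop, ?_, fun t ht => ?_, fun t => ?_⟩
  · intro h0
    apply hf
    ext t
    simpa [hw0'] using congrFun h0 t
  · have := hs 0 le_rfl t ht
    simp only [pow_zero, Module.End.one_apply] at this
    simp [this]
  · simp [Matrix.mulVec_smul, hB, hD]

end LTISystem

/-! ### From input redundancy to a kernel vector of the pencil. -/

theorem locallyIntegrable_of_mem_inputSpace {m : ℕ} {u : Signal m} (hu : u ∈ inputSpace m) :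
    LocallyIntegrable u volume := by
  obtain ⟨h0, ⟨hfin, -, -⟩, M, a, hM⟩ := hu
  rw [locallyIntegrable_iff]
  intro k hk
  obtain ⟨T, hT⟩ := hk.bddAbove
  have hsub : k ⊆ Iio 0 ∪ Icc 0 T := by
    intro t ht
    rcases lt_or_ge t 0 with h | h
    · exact Or.inl h
    · exact Or.inr ⟨h, hT ht⟩
  refine IntegrableOn.mono_set (IntegrableOn.union ?_ ?_) hsub
  · exact IntegrableOn.congr_fun (f := fun _ => 0) integrableOn_zero (fun t ht => (h0 t ht).symm)
      measurableSet_Iio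
  · have hmeas : AEStronglyMeasurable u (volume.restrict (Icc 0 T)) := by
      have hF := hfin T
      set F := {t ∈ Icc 0 T | ¬ ContinuousWithinAt u (Ici 0) t}
      have hae : Icc 0 T =ᵐ[volume] (Icc 0 T \ F : Set ℝ) :=
        (sdiff_null_ae_eq_self (hF.measure_zero volume)).symm
      rw [Measure.restrict_congr_set hae]
      refine ContinuousOn.aestronglyMeasurable (fun t ht => ?_)
        (measurableSet_Icc.diff hF.measurableSet)
      have hc : ContinuousWithinAt u (Ici 0) t := by
        by_contra hc
        exact ht.2 ⟨ht.1, hc⟩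
      exact hc.mono fun s hs => hs.1.1
    obtain ⟨K, hK⟩ := (isCompact_Icc (a := (0 : ℝ)) (b := T)).exists_bound_of_continuousOn
      (f := fun t => M * Real.exp (a * t)) (by fun_prop)
    have : IsFiniteMeasure (volume.restrict (Icc 0 T)) := ⟨by simp⟩
    refine Integrable.of_bound hmeas K ?_
    filter_upwards [ae_restrict_mem measurableSet_Icc] with t ht
    exact (hM t ht.1).trans ((le_abs_self _).trans (hK t ht))

theorem add_continuous_mem_inputSpace {m : ℕ} {u v : Signal m} (hu : u ∈ inputSpace m)
    (hv : Continuous v) (h0 : ∀ t < 0, v t = 0) {K : ℝ} (hK : ∀ t, ‖v t‖ ≤ K) :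
    u + v ∈ inputSpace m := by
  obtain ⟨hu0, ⟨hfin, hl, hr⟩, M, a, hM⟩ := hu
  refine ⟨fun t ht => by simp [hu0 t ht, h0 t ht], ⟨fun T => ?_, fun t ht => ?_, fun t ht => ?_⟩,
    |M| + K, |a|, fun t ht => ?_⟩
  · refine (hfin T).subset fun t ht => ⟨ht.1, fun hc => ht.2 ?_⟩
    exact hc.add hv.continuousWithinAt
  · obtain ⟨l, h⟩ := hl t ht
    exact ⟨_, h.add ((hv.tendsto t).mono_left nhdsWithin_le_nhds)⟩
  · obtain ⟨l, h⟩ := hr t ht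
    exact ⟨_, h.add ((hv.tendsto t).mono_left nhdsWithin_le_nhds)⟩
  · have hK0 : 0 ≤ K := (norm_nonneg _).trans (hK 0)
    have h1 : ‖u t‖ ≤ |M| * Real.exp (|a| * t) :=
      (hM t ht).trans (mul_le_mul (le_abs_self M)
        (Real.exp_le_exp.2 (mul_le_mul_of_nonneg_right (le_abs_self a) ht))
        (Real.exp_pos _).le (abs_nonneg M))
    have h2 : K ≤ K * Real.exp (|a| * t) :=
      le_mul_of_one_le_right hK0 (Real.one_le_exp (by positivity))
    calc ‖(u + v) t‖ ≤ ‖u t‖ + ‖v t‖ := norm_add_le _ _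
      _ ≤ |M| * Real.exp (|a| * t) + K * Real.exp (|a| * t) :=
        add_le_add h1 ((hK t).trans h2)
      _ = (|M| + K) * Real.exp (|a| * t) := by ring

namespace LTISystem

variable {n m p : ℕ}

theorem intervalIntegrable_dynamics (S : LTISystem n m p) {u : Signal m} {x : Signal n}
    {t : ℝ} (hu : LocallyIntegrable u volume) (hx : ContinuousOn x (Ici 0)) (ht : 0 ≤ t) :
    IntervalIntegrable (fun s => S.A *ᵥ x s + S.B *ᵥ u s) volume 0 t := by
  refine IntervalIntegrable.add (ContinuousOn.intervalIntegrable ?_) ?_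
  · rw [uIcc_of_le ht]
    exact (S.A.mulVecLin.toContinuousLinearMap.continuous.comp_continuousOn hx).mono
      Icc_subset_Ici_self
  · have h1 : LocallyIntegrable (fun s => S.B *ᵥ u s) volume := by
      rw [locallyIntegrable_iff] at hu ⊢
      exact fun k hk => S.B.mulVecLin.toContinuousLinearMap.integrable_comp (hu k hk)
    exact (h1.integrableOn_isCompact isCompact_uIcc).intervalIntegrable

/-- The difference of two trajectories witnessing input redundancy, extended by zero. -/
theorem IsInputRedundant.exists_null_solution {S : LTISystem n m p} {U : Set (Fin m → ℝ)}
    {X : Set (Fin n → ℝ)} (hS : S.IsInputRedundant U X) :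
    ∃ (v : Signal m) (z : Signal n), LocallyIntegrable v volume ∧ Continuous z ∧
      ¬ v =ᵐ[volume] 0 ∧
      (∀ t, z t = ∫ s in (0 : ℝ)..t, (S.A *ᵥ z s + S.B *ᵥ v s)) ∧
      ∀ᵐ t, S.C *ᵥ z t + S.D *ᵥ v t = 0 := by
  obtain ⟨⟨x₀, y⟩, -, u₁, y₁, u₂, y₂, ⟨x₁, ⟨hu₁, hx₁, -, ht₁, he₁⟩, -⟩,
    ⟨x₂, ⟨hu₂, hx₂, -, ht₂, he₂⟩, -⟩, hne, hy, -⟩ := hS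
  simp only at hu₁ hx₁ ht₁ he₁ hu₂ hx₂ ht₂ he₂ hne hy
  have hv₁ := locallyIntegrable_of_mem_inputSpace hu₁
  have hv₂ := locallyIntegrable_of_mem_inputSpace hu₂
  have hneg : ∀ t < 0, (u₁ - u₂) t = 0 := fun t ht => by simp [hu₁.1 t ht, hu₂.1 t ht]
  -- Both states start at x₀, so freezing time at 0 extends the difference continuously by zero to
  -- negative times.
  let z : Signal n := fun t => x₁ (max t 0) - x₂ (max t 0)
  have hzneg : ∀ t ≤ 0, z t = 0 := by
    intro t ht
    have h1 : x₁ 0 = x₀ := by simpa using ht₁ 0 le_rfl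
    have h2 : x₂ 0 = x₀ := by simpa using ht₂ 0 le_rfl
    simp [z, max_eq_right ht, h1, h2]
  have hzpos : ∀ t, 0 ≤ t → z t = x₁ t - x₂ t := fun t ht => by simp [z, max_eq_left ht]
  refine ⟨u₁ - u₂, z, hv₁.sub hv₂, ?_, ?_, fun t => ?_, ?_⟩
  · have hmax : Continuous fun t : ℝ => max t 0 := by fun_prop
    exact (hx₁.comp_continuous hmax fun t => le_max_right t 0).sub
      (hx₂.comp_continuous hmax fun t => le_max_right t 0)
  · intro h
    refine hne (ae_restrict_of_ae ?_)
    filter_upwards [h] with t ht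
    exact sub_eq_zero.1 ht
  · rcases le_total 0 t with h | h
    · rw [hzpos t h, ht₁ t h, ht₂ t h, add_sub_add_left_eq_sub,
        ← intervalIntegral.integral_sub (S.intervalIntegrable_dynamics hv₁ hx₁ h)
          (S.intervalIntegrable_dynamics hv₂ hx₂ h)]
      refine intervalIntegral.integral_congr fun s hs => ?_
      rw [uIcc_of_le h] at hs
      simp only [hzpos s hs.1, Pi.sub_apply, Matrix.mulVec_sub]
      abel
    · rw [hzneg t h, intervalIntegral.integral_zero_ae]
      filter_upwards [Measure.ae_ne volume (0 : ℝ)] with s hs0 hs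
      rw [uIoc_of_ge h] at hs
      rw [hzneg s hs.2, hneg s (lt_of_le_of_ne hs.2 hs0)]
      simp
  · have h1 := (ae_restrict_iff' measurableSet_Ici).1 (hy.and (he₁.and he₂))
    filter_upwards [h1] with t ht
    rcases lt_or_ge t 0 with h | h
    · simp [hneg t h, hzneg t h.le]
    · obtain ⟨h1, h2, h3⟩ := ht h
      rw [h2, h3] at h1
      rw [hzpos t h, Pi.sub_apply, Matrix.mulVec_sub, Matrix.mulVec_sub]
      rw [sub_add_sub_comm, h1, sub_self]

-- The input v is only locally integrable and the output equation holds only almost everywhere.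
-- Integrating once replaces (z, v) by the continuous pair (Jz, w), w being the primitive of v, for
-- which the equations hold everywhere.
open Polynomial in
theorem IsInputRedundant.exists_pencil_mulVec_eq_zero {S : LTISystem n m p}
    {U : Set (Fin m → ℝ)} {X : Set (Fin n → ℝ)} (hS : S.IsInputRedundant U X) :
    ∃ g : Fin n ⊕ Fin m → ℝ[X], g ≠ 0 ∧ S.pencil *ᵥ g = 0 := by
  obtain ⟨v, z, hv, hz, hne, hdyn, hout⟩ := hS.exists_null_solution
  have hvint : ∀ a b, IntervalIntegrable v volume a b := fun a b =>
    (hv.integrableOn_isCompact isCompact_uIcc).intervalIntegrable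
  have hvi : ∀ (j : Fin m) a b, IntervalIntegrable (fun s => v s j) volume a b := fun j a b =>
    let L := ContinuousLinearMap.proj (R := ℝ) (φ := fun _ : Fin m => ℝ) j
    ⟨L.integrable_comp (hvint a b).1, L.integrable_comp (hvint a b).2⟩
  have hzi : ∀ j, Continuous fun s => z s j := fun j => (continuous_apply j).comp hz
  let zc : Fin n → C(ℝ, ℝ) := fun j => ⟨fun t => z t j, hzi j⟩
  let w : Fin m → C(ℝ, ℝ) := fun j => ⟨fun t => ∫ s in (0 : ℝ)..t, v s j,
    intervalIntegral.continuous_primitive (hvi j) 0⟩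
  have hsum : ∀ {q : ℕ} (M : Matrix (Fin q) (Fin n) ℝ) (N : Matrix (Fin q) (Fin m) ℝ) (i t),
      (∫ s in (0 : ℝ)..t, (M *ᵥ z s + N *ᵥ v s)) i =
        (∑ j, M i j • volterra ℝ (zc j) + ∑ j, N i j • w j) t := by
    intro q M N i t
    have hz1 : ∀ j, IntervalIntegrable (fun s => M i j * z s j) volume 0 t := fun j =>
      (continuous_const.mul (hzi j)).intervalIntegrable _ _
    have hv1 : ∀ j, IntervalIntegrable (fun s => N i j * v s j) volume 0 t := fun j =>
      (hvi j 0 t).const_mul _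
    have hM : IntervalIntegrable (fun s => M *ᵥ z s) volume 0 t :=
      (continuous_const.matrix_mulVec hz).intervalIntegrable _ _
    have hN : IntervalIntegrable (fun s => N *ᵥ v s) volume 0 t :=
      let L := N.mulVecLin.toContinuousLinearMap
      ⟨L.integrable_comp (hvint 0 t).1, L.integrable_comp (hvint 0 t).2⟩
    have hzs : IntervalIntegrable (fun s => ∑ j, M i j * z s j) volume 0 t := by
      simpa only [Finset.sum_fn] using IntervalIntegrable.sum Finset.univ fun j _ => hz1 j
    have hvs : IntervalIntegrable (fun s => ∑ j, N i j * v s j) volume 0 t := by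
      simpa only [Finset.sum_fn] using IntervalIntegrable.sum Finset.univ fun j _ => hv1 j
    have h1 := (ContinuousLinearMap.proj (R := ℝ) (φ := fun _ : Fin q => ℝ)
      i).intervalIntegral_comp_comm (hM.add hN)
    simp only [ContinuousLinearMap.proj_apply] at h1
    rw [← h1]
    simp only [Pi.add_apply, Matrix.mulVec, dotProduct]
    rw [intervalIntegral.integral_add hzs hvs,
      intervalIntegral.integral_finsetSum fun j _ => hz1 j,
      intervalIntegral.integral_finsetSum fun j _ => hv1 j]
    simp [volterra_apply, zc, w]
  have hstate : ∀ i, zc i = ∑ j, S.A i j • volterra ℝ (zc j) + ∑ j, S.B i j • w j := by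
    intro i
    ext t
    rw [← hsum S.A S.B i t, ← hdyn t]
    rfl
  have houtput : ∀ i, ∑ j, S.C i j • volterra ℝ (zc j) + ∑ j, S.D i j • w j = 0 := by
    intro i
    ext t
    rw [← hsum S.C S.D i t, intervalIntegral.integral_zero_ae (hout.mono fun s hs _ => hs)]
    rfl
  refine exists_mulVec_eq_zero_of_representation (aeval (volterra ℝ)).toRingHom
    injective_aeval_volterra S.pencil (Sum.elim (fun j => volterra ℝ (zc j)) w) ?_ ?_
  · intro h0
    have hw : ∀ j, w j = 0 := fun j => congrFun h0 (.inr j)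
    apply hne
    -- Lebesgue differentiation: v is almost everywhere the derivative of its primitive w = 0.
    filter_upwards [LocallyIntegrable.ae_hasDerivAt_integral hv] with t ht
    funext j
    have h1 : HasDerivAt (w j) (v t j) t := by
      have h2 := (ContinuousLinearMap.proj (R := ℝ) (φ := fun _ : Fin m => ℝ)
        j).hasFDerivAt.comp_hasDerivAt t (ht 0)
      refine h2.congr_of_eventuallyEq (Eventually.of_forall fun s => ?_)
      exact (ContinuousLinearMap.proj (R := ℝ) (φ := fun _ : Fin m => ℝ)
        j).intervalIntegral_comp_comm (hvint 0 s)
    rw [hw j] at h1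
    exact h1.unique (hasDerivAt_const t 0)
  · rintro (i | i)
    -- `hstate` reads z = A Jz + B w; one more integration turns it into a relation between Jz and
    -- w, the state row of the pencil.
    · have h1 := congrArg (volterra ℝ) (hstate i)
      simp only [map_add, map_sum, map_smul] at h1
      simp only [pencil, Fintype.sum_sum_type, Matrix.fromBlocks_apply₁₁,
        Matrix.fromBlocks_apply₁₂, Matrix.sub_apply, Matrix.smul_apply, Matrix.map_apply,
        Matrix.neg_apply, smul_eq_mul, Matrix.one_apply, Sum.elim_inl, Sum.elim_inr]
      simp [Module.algebraMap_end_apply, apply_ite, ite_apply, h1]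
    · simpa [pencil, Module.algebraMap_end_apply] using houtput i

end LTISystem

/-! ### Small perturbations within the constraints. -/

/-- A piecewise continuous signal is continuous on some compact subinterval of any interval. -/
theorem PiecewiseContinuous.exists_continuousOn_Icc {k : ℕ} {u : Signal k}
    (hu : PiecewiseContinuous u) {t₀ tf : ℝ} (h0 : 0 ≤ t₀) (h : t₀ < tf) :
    ∃ a b, a < b ∧ Icc a b ⊆ Ioo t₀ tf ∧ ContinuousOn u (Icc a b) := by
  have hF := hu.1 tf
  set F := {t ∈ Icc 0 tf | ¬ ContinuousWithinAt u (Ici 0) t}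
  have hopen : IsOpen (Ioo t₀ tf \ F) := isOpen_Ioo.sdiff hF.isClosed
  obtain ⟨c, hc⟩ : (Ioo t₀ tf \ F).Nonempty := ((Ioo_infinite h).sdiff hF).nonempty
  obtain ⟨ε, hε, hball⟩ := Metric.nhds_basis_closedBall.mem_iff.1 (hopen.mem_nhds hc)
  rw [Real.closedBall_eq_Icc] at hball
  refine ⟨c - ε, c + ε, by linarith, fun t ht => (hball ht).1, fun t ht => ?_⟩
  have h1 := hball ht
  have hct : ContinuousWithinAt u (Ici 0) t := by
    by_contra hct
    exact h1.2 ⟨⟨h0.trans h1.1.1.le, h1.1.2.le⟩, hct⟩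
  exact hct.mono fun s hs => h0.trans (hball hs).1.1.le

theorem exists_norm_le_of_supported {k : ℕ} {v : Signal k} (hv : Continuous v) {a b : ℝ}
    (hs : ∀ t ∉ Ioo a b, v t = 0) : ∃ K, 0 < K ∧ ∀ t, ‖v t‖ ≤ K := by
  obtain ⟨K, hK⟩ := (isCompact_Icc (a := a) (b := b)).exists_bound_of_continuousOn hv.continuousOn
  -- The maximum with 1 makes the bound positive, hence usable as a divisor when the scale is
  -- chosen.
  refine ⟨max K 1, by positivity, fun t => ?_⟩
  by_cases ht : t ∈ Ioo a b
  · exact (hK t (Ioo_subset_Icc_self ht)).trans (le_max_left _ _)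
  · simp [hs t ht]

/-- A signal continuous on a compact interval with values in the interior of `U` keeps its values
in `U` under small perturbations. -/
theorem exists_pos_add_mem {k : ℕ} {u : Signal k} {U : Set (Fin k → ℝ)} {a b : ℝ}
    (hu : ContinuousOn u (Icc a b)) (hU : ∀ t ∈ Icc a b, u t ∈ interior U) :
    ∃ δ, 0 < δ ∧ ∀ t ∈ Icc a b, ∀ w, ‖w‖ ≤ δ → u t + w ∈ U := by
  obtain ⟨δ, hδ, hsub⟩ := (isCompact_Icc.image_of_continuousOn hu).exists_cthickening_subset_open
    isOpen_interior (image_subset_iff.2 hU)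
  refine ⟨δ, hδ, fun t ht w hw => interior_subset (hsub ?_)⟩
  refine Metric.mem_cthickening_of_dist_le _ (u t) _ _ (mem_image_of_mem u ht) ?_
  simpa using hw

namespace LTISystem

variable {n m p : ℕ}

/-- Adding a nonzero null solution that respects the constraints proves input redundancy. -/
theorem mem_redundantPairs_of_add {S : LTISystem n m p} {U : Set (Fin m → ℝ)}
    {X : Set (Fin n → ℝ)} {x₀ : Fin n → ℝ} {u v : Signal m} {x z : Signal n} {y : Signal p}
    (hx₀ : x₀ ∈ X) (hq : (u, x, y) ∈ S.triples U X x₀)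
    (hv : Continuous v) (hz : Continuous z) (hv0 : v ≠ 0) {a b : ℝ} (ha : 0 ≤ a)
    (hvs : ∀ t ∉ Ioo a b, v t = 0)
    (hdyn : ∀ t, z t = ∫ s in (0 : ℝ)..t, (S.A *ᵥ z s + S.B *ᵥ v s))
    (hout : ∀ t, S.C *ᵥ z t + S.D *ᵥ v t = 0)
    (hU : ∀ t, 0 ≤ t → u t + v t ∈ U) (hX : ∀ t, 0 ≤ t → x t + z t ∈ X) :
    (x₀, y) ∈ S.redundantPairs U X := by
  obtain ⟨⟨hu, hx, hy, htr, hyeq⟩, hcon⟩ := id hq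
  simp only at hu hx hy htr hyeq
  have hneg : ∀ t < 0, v t = 0 := fun t ht => hvs t fun h => (ht.trans_le ha).not_gt h.1
  obtain ⟨K, -, hK⟩ := exists_norm_le_of_supported hv hvs
  have huv : u + v ∈ inputSpace m := add_continuous_mem_inputSpace hu hv hneg hK
  have hxz : x + z ∈ stateSpace n := ContinuousOn.add hx hz.continuousOn
  refine ⟨⟨hx₀, hy⟩, u, y, u + v, y, ⟨x, hq⟩, ⟨x + z, ⟨huv, hxz, hy, ?_, ?_⟩,
    ⟨hU, huv⟩, ⟨hX, hxz⟩, hy⟩, ?_, ae_of_all _ fun _ => rfl, ae_of_all _ fun _ => rfl⟩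
  · intro t ht
    have h1 := S.intervalIntegrable_dynamics (locallyIntegrable_of_mem_inputSpace hu) hx ht
    have h2 := S.intervalIntegrable_dynamics hv.locallyIntegrable hz.continuousOn ht
    have h3 : ∀ s, S.A *ᵥ (x + z) s + S.B *ᵥ (u + v) s =
        (S.A *ᵥ x s + S.B *ᵥ u s) + (S.A *ᵥ z s + S.B *ᵥ v s) := fun s => by
      simp only [Pi.add_apply, Matrix.mulVec_add]
      abel
    simp only [h3]
    rw [intervalIntegral.integral_add h1 h2, Pi.add_apply, ← hdyn t, htr t ht, add_assoc]
  · filter_upwards [hyeq] with t ht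
    simp only [ht, Pi.add_apply, Matrix.mulVec_add]
    rw [add_add_add_comm, hout, add_zero]
  · intro h
    have h1 := (ae_restrict_iff' measurableSet_Ici).1 h
    apply hv0
    refine (Continuous.ae_eq_iff_eq volume (g := 0) hv continuous_zero).1 ?_
    filter_upwards [h1] with t ht
    rcases lt_or_ge t 0 with h | h
    · exact hneg t h
    · simpa using ht h

/-- Scaling: a nonzero null solution supported in `[a, b]` proves input redundancy as soon as the
input stays in the interior of `U` on `[a, b]`, and so does the state, unless it is unchanged. -/
theorem mem_redundantPairs_of_null_solution {S : LTISystem n m p} {U : Set (Fin m → ℝ)}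
    {X : Set (Fin n → ℝ)} {x₀ : Fin n → ℝ} {u v : Signal m} {x z : Signal n} {y : Signal p}
    (hx₀ : x₀ ∈ X) (hq : (u, x, y) ∈ S.triples U X x₀)
    (hv : Continuous v) (hz : Continuous z) (hv0 : v ≠ 0) {a b : ℝ} (ha : 0 ≤ a)
    (hvs : ∀ t ∉ Ioo a b, v t = 0) (hzs : ∀ t ∉ Ioo a b, z t = 0)
    (hdyn : ∀ t, z t = ∫ s in (0 : ℝ)..t, (S.A *ᵥ z s + S.B *ᵥ v s))
    (hout : ∀ t, S.C *ᵥ z t + S.D *ᵥ v t = 0)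
    (huc : ContinuousOn u (Icc a b)) (hU : ∀ t ∈ Icc a b, u t ∈ interior U)
    (hX : z = 0 ∨ ∀ t ∈ Icc a b, x t ∈ interior X) :
    (x₀, y) ∈ S.redundantPairs U X := by
  obtain ⟨⟨-, hx, -⟩, ⟨huU, -⟩, ⟨hxX, -⟩, -⟩ := id hq
  simp only at hx huU hxX
  obtain ⟨K, hK, hvK⟩ := exists_norm_le_of_supported hv hvs
  obtain ⟨L, hL, hzL⟩ := exists_norm_le_of_supported hz hzs
  obtain ⟨δ, hδ, hδU⟩ := exists_pos_add_mem huc hU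
  obtain ⟨η, hη, hηX⟩ : ∃ η > 0, ∀ t ∈ Icc a b, ∀ c : ℝ, ‖c • z t‖ ≤ η → x t + c • z t ∈ X := by
    rcases hX with hz0 | hX
    · exact ⟨1, one_pos, fun t ht c _ => by simpa [hz0] using hxX t (ha.trans ht.1)⟩
    · have hxc : ContinuousOn x (Icc a b) :=
        ContinuousOn.mono hx fun t ht => ha.trans ht.1
      obtain ⟨η, hη, h⟩ := exists_pos_add_mem hxc hX
      exact ⟨η, hη, fun t ht c => h t ht _⟩
  -- This scale keeps c v within the margin δ for the input and c z within the margin η for the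
  -- state.
  set c := min (δ / K) (η / L)
  have hc : 0 < c := by positivity
  have hcK : c * K ≤ δ := (le_div_iff₀ hK).1 (min_le_left _ _)
  have hcL : c * L ≤ η := (le_div_iff₀ hL).1 (min_le_right _ _)
  refine mem_redundantPairs_of_add (v := c • v) (z := c • z) hx₀ hq (hv.const_smul c)
    (hz.const_smul c) (smul_ne_zero hc.ne' hv0) ha (b := b) (fun t ht => ?_) (fun t => ?_)
    (fun t => ?_) (fun t ht => ?_) (fun t ht => ?_)
  · simp [hvs t ht]
  · simp only [Pi.smul_apply, Matrix.mulVec_smul, ← smul_add, intervalIntegral.integral_smul]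
    rw [← hdyn t]
  · simp only [Pi.smul_apply, Matrix.mulVec_smul, ← smul_add, hout, smul_zero]
  · by_cases h : t ∈ Ioo a b
    · refine hδU t (Ioo_subset_Icc_self h) _ ?_
      rw [Pi.smul_apply, norm_smul, Real.norm_of_nonneg hc.le]
      exact (mul_le_mul_of_nonneg_left (hvK t) hc.le).trans hcK
    · simpa [hvs t h] using huU t ht
  · by_cases h : t ∈ Ioo a b
    · refine hηX t (Ioo_subset_Icc_self h) c ?_
      rw [norm_smul, Real.norm_of_nonneg hc.le]
      exact (mul_le_mul_of_nonneg_left (hzL t) hc.le).trans hcL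
    · simpa [hzs t h] using hxX t ht

end LTISystem

/-! ### Conclusion. -/

theorem theorem1 {n m p : ℕ} (S : LTISystem n m p)
    (hS : S.IsInputRedundant Set.univ Set.univ)
    (U : Set (Fin m → ℝ)) (X : Set (Fin n → ℝ))
    (x₀ : Fin n → ℝ) (y : Signal p)
    (hadm : (x₀, y) ∈ S.admissiblePairs U X)
    (hwindow : ∃ (u : Signal m) (x : Signal n) (t₀ tf : ℝ), 0 ≤ t₀ ∧ t₀ < tf ∧
      (u, x, y) ∈ S.triples U X x₀ ∧
      (0 < S.rho → ∀ t ∈ Set.Ioo t₀ tf, u t ∈ interior U) ∧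
      (S.rho = 0 → ∀ t ∈ Set.Ioo t₀ tf, u t ∈ interior U ∧ x t ∈ interior X)) :
    (x₀, y) ∈ S.redundantPairs U X := by
  obtain ⟨u, x, t₀, tf, h0, hlt, hq, hpos, hzero⟩ := hwindow
  have hx₀ : x₀ ∈ X := hadm.1.1
  obtain ⟨a, b, hab, hsub, huc⟩ :=
    PiecewiseContinuous.exists_continuousOn_Icc hq.1.1.2.1 h0 hlt
  have ha : 0 ≤ a := h0.trans (hsub (left_mem_Icc.2 hab.le)).1.le
  rcases Nat.eq_zero_or_pos S.rho with hρ | hρ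
  · obtain ⟨v, z, hv, hz, hv0, hvs, hzs, hdyn, hout⟩ :=
      S.exists_supported_null_solution_of_pencil hS.exists_pencil_mulVec_eq_zero ha hab
    exact LTISystem.mem_redundantPairs_of_null_solution hx₀ hq hv hz hv0 ha hvs hzs hdyn hout huc
      (fun t ht => (hzero hρ t (hsub ht)).1) (Or.inr fun t ht => (hzero hρ t (hsub ht)).2)
  -- Here the perturbation is invisible to the dynamics, so z = 0 and the state constraint holds as
  -- before.
  · obtain ⟨v, hv, hv0, hvs, hnull⟩ := S.exists_supported_null_input hρ ha hab
    exact LTISystem.mem_redundantPairs_of_null_solution (z := 0) hx₀ hq hv continuous_const hv0 ha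
      hvs (fun _ _ => rfl) (fun t => by simp [(hnull _).1]) (fun t => by simp [(hnull t).2]) huc
      (fun t ht => hpos hρ t (hsub ht)) (Or.inl rfl)
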